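/- **Theorem 2.** Let $B$ be the set of positive nonincreasing functions $\psi$ on $[1,\infty)$ for which there is $K>0$ with $\psi(t)/\psi(2t)\le K$ for all $t\ge 1$. Let $\Theta_1$ be the set of continuous nonincreasing functions $\psi$ on $[1,\infty)$ for which there are $\alpha>1$ and $K>0$ with $t_1^{\alpha}\psi(t_1)\le K\,t_2^{\alpha}\psi(t_2)$ for all $t_1>t_2\ge 1$. For $\psi\in B\cap\Theta_1$ and $\beta\in\mathbb R$, let $\Psi_\beta$ be the $2\pi$-periodic function, summable over a period, with Fourier series $\sum_{k=1}^{\infty}\psi(k)\cos\left(kt-\frac{\beta\pi}{2}\right)$ (under these hypotheses $\Psi_\beta\in L_\infty$). Let $C^{\psi}_{\beta,1}$ be the class of continuous real-valued functions of the form $$f(x)=\frac{a_0}{2}+\frac1\pi\int_{-\pi}^{\pi}\Psi_\beta(x-t)\varphi(t)\,dt,\qquad x\in\mathbb R,$$ where $a_0\in\mathbb R$ and $\varphi$ is a real-valued, $2\pi$-periodic function, summable over a period, with $\int_{-\pi}^{\pi}\varphi(t)\,dt=0$ and $\int_{-\pi}^{\pi}|\varphi(t)|\,dt\le 1$. For $n\in\mathbb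 N=\{1,2,\dots\}$ put $$E_n(C^{\psi}_{\beta,1})_C=\sup_{f\in C^{\psi}_{\beta,1}}\ \inf_{t_{n-1}}\|f-t_{n-1}\|_C,\qquad \mathcal E_n(C^{\psi}_{\beta,1})_C=\sup_{f\in C^{\psi}_{\beta,1}}\|f-S_{n-1}(f)\|_C,$$ where $\|g\|_C=\max_{t}|g(t)|$, the infimum is over all real trigonometric polynomials $t_{n-1}$ of order at most $n-1$, and $S_{n-1}(f)$ is the Fourier sum of $f$ of order $n-1$. Let $\psi\in B\cap\Theta_1$, and suppose that, with $\Delta^2(1/\psi(k))=\frac1{\psi(k)}-\frac2{\psi(k+1)}+\frac1{\psi(k+2)}$, either $\Delta^2(1/\psi(k))\ge 0$ for all $k\in\mathbb N$ or $\Delta^2(1/\psi(k))\le 0$ for all $k\in\mathbb N$. Then there exist positive numbers $K^{(1)}_\psi$ and $K^{(2)}_\psi$, depending only on $\psi$, such that for all $\beta\in\mathbb R$ and all $n\in\mathbb N$ $$K^{(2)}_\psi\,\psi(n)\,n\le E_n(C^{\psi}_{\beta,1})_C\le \mathcal E_n(C^{\psi}_{\beta,1})_C\le K^{(1)}_\psi\,\psi(n)\,n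 .$$ -/

import Mathlib

open MeasureTheory Real
open scoped ENNReal

namespace PsiBeta

noncomputable section

/-- Cosine Fourier coefficient `a_k(f) = (1/π) ∫_{-π}^{π} f(t) cos(kt) dt`. -/
def cosCoeff (f : ℝ → ℝ) (k : ℕ) : ℝ :=
  (1 / π) * ∫ t in (-π)..π, f t * cos (k * t)

/-- Sine Fourier coefficient `b_k(f) = (1/π) ∫_{-π}^{π} f(t) sin(kt) dt`. -/
def sinCoeff (f : ℝ → ℝ) (k : ℕ) : ℝ :=
  (1 / π) * ∫ t in (-π)..π, f t * sin (k * t)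

/-- The real trigonometric polynomial of order at most `m`
`a_0 / 2 + ∑_{k=1}^{m} (a_k cos kx + b_k sin kx)`. -/
def trigPoly (m : ℕ) (a b : ℕ → ℝ) (x : ℝ) : ℝ :=
  a 0 / 2 + ∑ k ∈ Finset.Icc 1 m, (a k * cos (k * x) + b k * sin (k * x))

/-- The space of real trigonometric polynomials of order at most `m`. -/
def trigPolys (m : ℕ) : Set (ℝ → ℝ) :=
  {T | ∃ a b : ℕ → ℝ, T = trigPoly m a b}

/-- The Fourier sum `S_m(f; ·)` of order `m`. -/
def fourierSum (m : ℕ) (f : ℝ → ℝ) : ℝ → ℝ :=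
  trigPoly m (cosCoeff f) (sinCoeff f)

/-- The uniform norm, with values in `[0, ∞]`. -/
def normC (g : ℝ → ℝ) : ℝ≥0∞ := ⨆ t : ℝ, ‖g t‖ₑ

/-- Lebesgue measure on one period. -/
def periodMeasure : Measure ℝ := volume.restrict (Set.Ioc (-π) π)

/-- `Ψ` is a `2π`-periodic summable function whose Fourier series is
`∑_{k ≥ 1} ψ(k) cos(kt - βπ/2)
  = ∑_{k ≥ 1} (ψ(k) cos(βπ/2) cos kt + ψ(k) sin(βπ/2) sin kt)`. -/
structure IsKernel (ψ : ℝ → ℝ) (β : ℝ) (Ψ : ℝ → ℝ) : Prop where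
  periodic : Function.Periodic Ψ (2 * π)
  integrable : Integrable Ψ periodMeasure
  cosCoeff_zero : cosCoeff Ψ 0 = 0
  cosCoeff_eq : ∀ k : ℕ, 1 ≤ k → cosCoeff Ψ k = ψ k * cos (β * π / 2)
  sinCoeff_eq : ∀ k : ℕ, 1 ≤ k → sinCoeff Ψ k = ψ k * sin (β * π / 2)

/-- The class `C^ψ_{β,p}`: continuous functions
`f(x) = a₀/2 + (1/π) ∫_{-π}^{π} Ψ_β(x - t) φ(t) dt`
with `φ` a `2π`-periodic function of mean zero, `‖φ‖_p ≤ 1`, and `Ψ_β ∈ L_{p'}`,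
`1/p + 1/p' = 1`. -/
def classC (ψ : ℝ → ℝ) (β : ℝ) (p : ℝ≥0∞) : Set (ℝ → ℝ) :=
  {f | Continuous f ∧ ∃ (Ψ φ : ℝ → ℝ) (a₀ : ℝ),
    IsKernel ψ β Ψ ∧ MemLp Ψ p.conjExponent periodMeasure ∧
    Function.Periodic φ (2 * π) ∧ MemLp φ p periodMeasure ∧
    eLpNorm φ p periodMeasure ≤ 1 ∧ (∫ t in (-π)..π, φ t) = 0 ∧
    ∀ x, f x = a₀ / 2 + (1 / π) * ∫ t in (-π)..π, Ψ (x - t) * φ t}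

/-- `𝓔_n(N)_C`: the supremum over `f ∈ N` of `‖f - S_{n-1}(f)‖_C` (for `n ≥ 1`). -/
def fourierApprox (n : ℕ) (N : Set (ℝ → ℝ)) : ℝ≥0∞ :=
  ⨆ f ∈ N, normC (fun x => f x - fourierSum (n - 1) f x)

/-- `E_n(N)_C`: the supremum over `f ∈ N` of the distance from `f` to the trigonometric
polynomials of order at most `n - 1` in the uniform norm (for `n ≥ 1`). -/
def bestApprox (n : ℕ) (N : Set (ℝ → ℝ)) : ℝ≥0∞ :=
  ⨆ f ∈ N, ⨅ T ∈ trigPolys (n - 1), normC (fun x => f x - T x)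

/-- The set `Θ_p`: continuous nonincreasing functions `ψ` on `[1, ∞)` such that
`t ^ α * ψ t` is almost decreasing for some `α > 1/p`. Only values on `[1, ∞)` matter. -/
def Theta (p : ℝ) : Set (ℝ → ℝ) :=
  {ψ | ContinuousOn ψ (Set.Ici 1) ∧ AntitoneOn ψ (Set.Ici 1) ∧
    ∃ α : ℝ, 1 / p < α ∧ ∃ K : ℝ, 0 < K ∧
      ∀ t₁ t₂ : ℝ, 1 ≤ t₂ → t₂ < t₁ → t₁ ^ α * ψ t₁ ≤ K * (t₂ ^ α * ψ t₂)}

/-- The set `B`: positive nonincreasing functions `ψ` on `[1, ∞)` with `ψ(t)/ψ(2t)` bounded.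
Only values on `[1, ∞)` matter. -/
def setB : Set (ℝ → ℝ) :=
  {ψ | (∀ t : ℝ, 1 ≤ t → 0 < ψ t) ∧ AntitoneOn ψ (Set.Ici 1) ∧
    ∃ K : ℝ, 0 < K ∧ ∀ t : ℝ, 1 ≤ t → ψ t / ψ (2 * t) ≤ K}

/-- `Δ²(1/ψ(k)) = 1/ψ(k) - 2/ψ(k+1) + 1/ψ(k+2)`. -/
def secondDiffInv (ψ : ℝ → ℝ) (k : ℕ) : ℝ :=
  1 / ψ k - 2 / ψ (k + 1) + 1 / ψ (k + 2)

end

end PsiBeta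

/-!
Since `t ^ α * ψ t` is almost decreasing for some `α > 1`, the numbers `ψ k` are summable and
`∑_{k ≥ n} ψ k` is at most a constant multiple of `n * ψ n`.

Upper bound: the function `f` in the class attached to `φ` has its `k`-th Fourier harmonic bounded
by `ψ k / π * ‖φ‖₁`, uniformly in the phase, so `f - S_{n-1}(f)` is controlled by the tail
`∑_{k ≥ n} ψ k`.

Lower bound: let `A = {n, …, 2n - 1}` and let `r k` be the number of ways to write `k` as a sum of
two elements of `A`. The cosine polynomial `∑ r k * cos (k x + d)` is the real part of the square of
`∑_{k ∈ A} exp (i (k x + d / 2))`, hence a difference of two squares, so its `L¹` norm over a period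
is at most `2π |A|`, whatever the phase `d`. Normalized, it serves both as `φ` (with `d = 0`) and as
a dual functional annihilating all trigonometric polynomials of order below `n`; testing `f` against
it yields `∑ ψ k * (r k)² / (4π |A|²)`. By doubling, `ψ k` is comparable to `ψ n` on `A + A`, and
`∑ (r k)²` is the additive energy of `A`, which is at least `|A|³ / 2` by Cauchy–Schwarz.
-/

namespace PsiBeta

open scoped Pointwise Finset

lemma integral_cos_int_mul_add (m : ℤ) (c : ℝ) :
    ∫ t in (-π)..π, cos (m * t + c) = if m = 0 then 2 * π * cos c else 0 := by
  split_ifs with hm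
  · subst hm
    simp only [Int.cast_zero, zero_mul, zero_add, intervalIntegral.integral_const, smul_eq_mul]
    ring
  · have hm' : (m : ℝ) ≠ 0 := by exact_mod_cast hm
    rw [intervalIntegral.integral_comp_mul_add (fun x => cos x) hm', integral_cos,
      sin_add, sin_add, mul_neg, sin_neg, cos_neg, sin_int_mul_pi]
    simp

lemma integral_cos_mul_cos {k : ℕ} (hk : 1 ≤ k) (l : ℕ) (c d : ℝ) :
    ∫ t in (-π)..π, cos (k * t + c) * cos (l * t + d) =
      if k = l then π * cos (c - d) else 0 := by
  have product_to_sum : ∀ t : ℝ, cos (k * t + c) * cos (l * t + d) =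
      (1 / 2) * cos ((k - l : ℤ) * t + (c - d)) + (1 / 2) * cos ((k + l : ℤ) * t + (c + d)) := by
    intro t
    have hsub : ((k - l : ℤ) : ℝ) * t + (c - d) = (k * t + c) - (l * t + d) := by push_cast; ring
    have hadd : ((k + l : ℤ) : ℝ) * t + (c + d) = (k * t + c) + (l * t + d) := by push_cast; ring
    rw [hsub, hadd, cos_sub, cos_add (k * t + c)]
    ring
  simp_rw [product_to_sum]
  rw [intervalIntegral.integral_add ((by fun_prop : Continuous _).intervalIntegrable _ _)
    ((by fun_prop : Continuous _).intervalIntegrable _ _),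
    intervalIntegral.integral_const_mul, intervalIntegral.integral_const_mul,
    integral_cos_int_mul_add, integral_cos_int_mul_add, if_neg (by omega : (k : ℤ) + l ≠ 0)]
  simp only [sub_eq_zero, Nat.cast_inj]
  split_ifs <;> ring

lemma intervalIntegrable_iff_integrable_periodMeasure {f : ℝ → ℝ} :
    IntervalIntegrable f volume (-π) π ↔ Integrable f periodMeasure :=
  intervalIntegrable_iff_integrableOn_Ioc_of_le (by linarith [pi_pos])

instance isFiniteMeasure_periodMeasure : IsFiniteMeasure periodMeasure := by
  unfold periodMeasure
  infer_instance

lemma memLp_periodMeasure {F : ℝ → ℝ} (hF : Continuous F) (p : ℝ≥0∞) :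
    MemLp F p periodMeasure := by
  obtain ⟨C, hC⟩ := isCompact_Icc.exists_bound_of_continuousOn (s := Set.Icc (-π) π) hF.continuousOn
  refine MemLp.of_bound hF.aestronglyMeasurable C ?_
  filter_upwards [ae_restrict_mem measurableSet_Ioc] with t ht
  exact hC t (Set.Ioc_subset_Icc_self ht)

lemma integral_mul_cos_add {F : ℝ → ℝ} (hF : IntervalIntegrable F volume (-π) π) (k : ℕ) (d : ℝ) :
    ∫ t in (-π)..π, F t * cos (k * t + d) = π * (cosCoeff F k * cos d - sinCoeff F k * sin d) := by
  have expand : ∀ t, F t * cos (k * t + d) =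
      F t * cos (k * t) * cos d - F t * sin (k * t) * sin d := fun t => by
    rw [cos_add]
    ring
  simp_rw [expand]
  rw [intervalIntegral.integral_sub ((hF.mul_continuousOn (by fun_prop)).mul_const _)
    ((hF.mul_continuousOn (by fun_prop)).mul_const _), intervalIntegral.integral_mul_const,
    intervalIntegral.integral_mul_const, cosCoeff, sinCoeff]
  field_simp

lemma cosCoeff_zero_eq (F : ℝ → ℝ) : cosCoeff F 0 = (1 / π) * ∫ t in (-π)..π, F t := by
  simp [cosCoeff]

lemma sinCoeff_zero (F : ℝ → ℝ) : sinCoeff F 0 = 0 := by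
  simp [sinCoeff]

lemma cosCoeff_sub {F G : ℝ → ℝ} (hF : IntervalIntegrable F volume (-π) π)
    (hG : IntervalIntegrable G volume (-π) π) (k : ℕ) :
    cosCoeff (F - G) k = cosCoeff F k - cosCoeff G k := by
  simp only [cosCoeff, Pi.sub_apply, sub_mul]
  rw [intervalIntegral.integral_sub (hF.mul_continuousOn (by fun_prop))
    (hG.mul_continuousOn (by fun_prop)), mul_sub]

lemma sinCoeff_sub {F G : ℝ → ℝ} (hF : IntervalIntegrable F volume (-π) π)
    (hG : IntervalIntegrable G volume (-π) π) (k : ℕ) :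
    sinCoeff (F - G) k = sinCoeff F k - sinCoeff G k := by
  simp only [sinCoeff, Pi.sub_apply, sub_mul]
  rw [intervalIntegral.integral_sub (hF.mul_continuousOn (by fun_prop))
    (hG.mul_continuousOn (by fun_prop)), mul_sub]

lemma fourier_smul_ofReal (i : ℤ) (x y : ℝ) :
    fourier (-i) (x : AddCircle (π - -π)) • (y : ℂ) =
      ((y * cos (i.natAbs * x) : ℝ) : ℂ) -
        i.sign * Complex.I * ((y * sin (i.natAbs * x) : ℝ) : ℂ) := by
  have exponent : 2 * π * Complex.I * (-i : ℤ) * x / (π - -π : ℝ) =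
      ((-(i * x) : ℝ) : ℂ) * Complex.I := by
    have hπ : (π : ℂ) ≠ 0 := by exact_mod_cast pi_ne_zero
    push_cast
    field_simp
    ring
  have hcos : cos (i * x) = cos (i.natAbs * x) := by
    rcases Int.natAbs_eq i with h | h <;> rw [h] <;> simp
  have hsin : sin (i * x) = i.sign * sin (i.natAbs * x) := by
    rcases lt_trichotomy i 0 with h | rfl | h
    · rw [Int.sign_eq_neg_one_of_neg h, ← Int.cast_natCast, Int.ofNat_natAbs_of_nonpos h.le]
      simp
    · simp
    · rw [Int.sign_eq_one_of_pos h, ← Int.cast_natCast, Int.natAbs_of_nonneg h.le]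
      simp
  rw [fourier_coe_apply, exponent, Complex.exp_mul_I, ← Complex.ofReal_cos, ← Complex.ofReal_sin,
    cos_neg, sin_neg, hcos, hsin, smul_eq_mul]
  push_cast
  ring

lemma fourierCoeffOn_ofReal {F : ℝ → ℝ} (hF : IntervalIntegrable F volume (-π) π)
    (hlt : -π < π) (i : ℤ) :
    fourierCoeffOn hlt (fun x => (F x : ℂ)) i =
      (cosCoeff F i.natAbs - i.sign * Complex.I * sinCoeff F i.natAbs) / 2 := by
  have hmul : ∀ g : ℝ → ℝ, Continuous g →
      IntervalIntegrable (fun x => ((F x * g x : ℝ) : ℂ)) volume (-π) π := fun g hg =>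
    have h := hF.mul_continuousOn hg.continuousOn
    ⟨h.1.ofReal, h.2.ofReal⟩
  have hπ : (π : ℂ) ≠ 0 := by exact_mod_cast pi_ne_zero
  rw [fourierCoeffOn_eq_integral]
  simp_rw [fourier_smul_ofReal]
  rw [intervalIntegral.integral_sub (hmul _ (by fun_prop)) ((hmul _ (by fun_prop)).const_mul _),
    intervalIntegral.integral_const_mul, intervalIntegral.integral_ofReal,
    intervalIntegral.integral_ofReal, cosCoeff, sinCoeff, Complex.real_smul]
  push_cast
  field_simp
  ring

lemma ae_eq_of_coeff_eq {F G : ℝ → ℝ} (hF : MemLp F 2 periodMeasure)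
    (hG : MemLp G 2 periodMeasure) (hcos : ∀ k, cosCoeff F k = cosCoeff G k)
    (hsin : ∀ k, sinCoeff F k = sinCoeff G k) : F =ᵐ[periodMeasure] G := by
  have hlt : -π < π := by linarith [pi_pos]
  have hFi := intervalIntegrable_iff_integrable_periodMeasure.2 (hF.integrable one_le_two)
  have hGi := intervalIntegrable_iff_integrable_periodMeasure.2 (hG.integrable one_le_two)
  have hD : MemLp (fun x => ((F - G) x : ℂ)) 2 periodMeasure := (hF.sub hG).ofReal
  have coeff_eq_zero : ∀ i, fourierCoeffOn hlt (fun x => ((F - G) x : ℂ)) i = 0 := fun i => by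
    rw [fourierCoeffOn_ofReal (F := F - G) (hFi.sub hGi), cosCoeff_sub hFi hGi,
      sinCoeff_sub hFi hGi, hcos, hsin]
    simp
  have parseval := hasSum_sq_fourierCoeffOn hlt hD
  simp only [coeff_eq_zero, norm_zero, ne_eq, OfNat.ofNat_ne_zero, not_false_eq_true, zero_pow,
    smul_eq_mul] at parseval
  have integral_sq : ∫ x, ‖((F - G) x : ℂ)‖ ^ 2 ∂periodMeasure = 0 := by
    rw [periodMeasure, ← intervalIntegral.integral_of_le hlt.le]
    have hinv : (π - -π)⁻¹ ≠ 0 := inv_ne_zero (sub_pos.2 hlt).ne'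
    exact (mul_eq_zero.1 (hasSum_zero.unique parseval).symm).resolve_left hinv
  rw [integral_eq_zero_iff_of_nonneg (fun x => by positivity)
    ((memLp_two_iff_integrable_sq_norm hD.1).1 hD)] at integral_sq
  filter_upwards [integral_sq] with x hx
  simpa [sub_eq_zero, ← Complex.ofReal_sub] using hx

/-- The term of order `k` of the trigonometric series with coefficients `a` and `b`. -/
noncomputable def trigTerm (a b : ℕ → ℝ) (k : ℕ) (x : ℝ) : ℝ :=
  a k * cos (k * x) + b k * sin (k * x)

/-- The trigonometric series `a₀ / 2 + ∑_{k ≥ 1} (a_k cos kx + b_k sin kx)`, where a divergent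
sum counts as `0`. -/
noncomputable def trigSeries (a b : ℕ → ℝ) (x : ℝ) : ℝ :=
  a 0 / 2 + ∑' k : ℕ, trigTerm a b (k + 1) x

lemma abs_trigTerm_le (a b : ℕ → ℝ) (k : ℕ) (x : ℝ) : |trigTerm a b k x| ≤ |a k| + |b k| := by
  refine (abs_add_le _ _).trans (add_le_add ?_ ?_) <;> rw [abs_mul]
  · exact mul_le_of_le_one_right (abs_nonneg _) (abs_cos_le_one _)
  · exact mul_le_of_le_one_right (abs_nonneg _) (abs_sin_le_one _)

@[fun_prop]
lemma continuous_trigTerm (a b : ℕ → ℝ) (k : ℕ) : Continuous (trigTerm a b k) := by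
  unfold trigTerm
  fun_prop

lemma trigTerm_eq_cos (a b : ℕ → ℝ) (k : ℕ) (x : ℝ) :
    trigTerm a b k x = a k * cos (k * x + 0) + b k * cos (k * x + -(π / 2)) := by
  rw [trigTerm, ← sub_eq_add_neg, cos_sub_pi_div_two, add_zero]

lemma integral_trigTerm_mul_cos (a b : ℕ → ℝ) {k : ℕ} (hk : 1 ≤ k) (j : ℕ) (d : ℝ) :
    ∫ t in (-π)..π, trigTerm a b k t * cos (j * t + d) =
      if k = j then π * (a k * cos d - b k * sin d) else 0 := by
  have expand : ∀ t, trigTerm a b k t * cos (j * t + d) =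
      a k * (cos (k * t + 0) * cos (j * t + d)) +
        b k * (cos (k * t + -(π / 2)) * cos (j * t + d)) := fun t => by
    rw [trigTerm_eq_cos]
    ring
  simp_rw [expand]
  rw [intervalIntegral.integral_add ((by fun_prop : Continuous _).intervalIntegrable _ _)
    ((by fun_prop : Continuous _).intervalIntegrable _ _),
    intervalIntegral.integral_const_mul, intervalIntegral.integral_const_mul,
    integral_cos_mul_cos hk, integral_cos_mul_cos hk]
  split_ifs
  · rw [zero_sub, cos_neg, show -(π / 2) - d = -(d + π / 2) by ring, cos_neg, cos_add_pi_div_two]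
    ring
  · simp

lemma convolution_trigTerm {φ : ℝ → ℝ} (hφ : IntervalIntegrable φ volume (-π) π) (a b : ℕ → ℝ)
    (k : ℕ) (x : ℝ) :
    (1 / π) * ∫ t in (-π)..π, trigTerm a b k (x - t) * φ t =
      trigTerm (fun k => a k * cosCoeff φ k - b k * sinCoeff φ k)
        (fun k => a k * sinCoeff φ k + b k * cosCoeff φ k) k x := by
  have expand : ∀ t, trigTerm a b k (x - t) * φ t =
      a k * (φ t * cos (k * t + -(k * x))) + b k * (φ t * cos (k * t + (π / 2 - k * x))) :=
    fun t => by
      rw [trigTerm, ← cos_pi_div_two_sub, ← cos_neg (k * (x - t))]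
      ring_nf
  simp_rw [expand]
  rw [intervalIntegral.integral_add
    ((hφ.mul_continuousOn (by fun_prop)).const_mul _)
    ((hφ.mul_continuousOn (by fun_prop)).const_mul _), intervalIntegral.integral_const_mul,
    intervalIntegral.integral_const_mul, integral_mul_cos_add hφ, integral_mul_cos_add hφ,
    cos_neg, sin_neg, cos_pi_div_two_sub, sin_pi_div_two_sub, trigTerm]
  field_simp
  ring

lemma hasSum_integral_mul {u : ℕ → ℝ → ℝ} {c : ℕ → ℝ} {g : ℝ → ℝ} {p q : ℝ} (hc : Summable c)
    (hu : ∀ k, Continuous (u k)) (hb : ∀ k t, |u k t| ≤ c k)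
    (hg : IntervalIntegrable g volume p q) :
    HasSum (fun k => ∫ t in p..q, u k t * g t) (∫ t in p..q, (∑' k, u k t) * g t) := by
  refine intervalIntegral.hasSum_integral_of_dominated_convergence (fun k t => c k * |g t|)
    (fun k => (hu k).aestronglyMeasurable.mul hg.def'.aestronglyMeasurable)
    (fun k => .of_forall fun t _ => ?_) (.of_forall fun t _ => hc.mul_right _) ?_
    (.of_forall fun t _ => (hc.of_norm_bounded fun k => hb k t).hasSum.mul_right (g t))
  · rw [norm_mul]
    exact mul_le_mul_of_nonneg_right (hb k t) (abs_nonneg _)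
  · simp_rw [tsum_mul_right]
    exact hg.abs.const_mul _

lemma trigPoly_eq_sum_range (m : ℕ) (a b : ℕ → ℝ) (x : ℝ) :
    trigPoly m a b x = a 0 / 2 + ∑ k ∈ Finset.range m, trigTerm a b (k + 1) x := by
  rw [trigPoly, Finset.range_eq_Ico, Finset.sum_Ico_add' (fun k => trigTerm a b k x) 0 m 1,
    zero_add, Finset.Ico_add_one_right_eq_Icc]
  rfl

@[fun_prop]
lemma continuous_trigPoly (m : ℕ) (a b : ℕ → ℝ) : Continuous (trigPoly m a b) := by
  unfold trigPoly
  fun_prop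

lemma integral_trigPoly_mul_cos (a b : ℕ → ℝ) {m j : ℕ} (hj : m < j) (d : ℝ) :
    ∫ x in (-π)..π, trigPoly m a b x * cos (j * x + d) = 0 := by
  have hj0 : (j : ℤ) ≠ 0 := by omega
  have constant_term := integral_cos_int_mul_add j d
  rw [if_neg hj0, Int.cast_natCast] at constant_term
  simp_rw [trigPoly_eq_sum_range, add_mul, Finset.sum_mul]
  rw [intervalIntegral.integral_add ((by fun_prop : Continuous _).intervalIntegrable _ _)
    ((by fun_prop : Continuous _).intervalIntegrable _ _),
    intervalIntegral.integral_const_mul, constant_term, mul_zero, zero_add,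
    intervalIntegral.integral_finsetSum fun k _ =>
      (by fun_prop : Continuous _).intervalIntegrable _ _]
  refine Finset.sum_eq_zero fun k hk => ?_
  have hkm := Finset.mem_range.1 hk
  rw [integral_trigTerm_mul_cos a b (Nat.le_add_left 1 k), if_neg (by omega)]

lemma periodic_trigSeries (a b : ℕ → ℝ) : Function.Periodic (trigSeries a b) (2 * π) := by
  intro x
  have periodic_trigTerm : ∀ k, trigTerm a b k (x + 2 * π) = trigTerm a b k x := fun k => by
    rw [trigTerm, mul_add, cos_add_nat_mul_two_pi, sin_add_nat_mul_two_pi, trigTerm]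
  simp only [trigSeries, periodic_trigTerm]

lemma trigSeries_update_zero (a b : ℕ → ℝ) (c x : ℝ) :
    trigSeries (Function.update a 0 c) b x = (c - a 0) / 2 + trigSeries a b x := by
  have trigTerm_update : ∀ k,
      trigTerm (Function.update a 0 c) b (k + 1) x = trigTerm a b (k + 1) x := fun k => by
    rw [trigTerm, Function.update_of_ne k.succ_ne_zero, trigTerm]
  simp only [trigSeries, trigTerm_update, Function.update_self]
  ring

section TrigSeries

variable {a b : ℕ → ℝ} (ha : Summable a) (hb : Summable b)
include ha hb

lemma summable_abs_add_abs (m : ℕ) : Summable fun k => |a (k + m)| + |b (k + m)| :=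
  (summable_nat_add_iff m).2 (ha.abs.add hb.abs)

lemma summable_trigTerm (x : ℝ) : Summable fun k => trigTerm a b (k + 1) x :=
  (summable_abs_add_abs ha hb 1).of_norm_bounded fun k => abs_trigTerm_le a b (k + 1) x

lemma continuous_tsum_trigTerm : Continuous fun x => ∑' k, trigTerm a b (k + 1) x :=
  continuous_tsum (fun k => continuous_trigTerm a b (k + 1)) (summable_abs_add_abs ha hb 1)
    fun k x => abs_trigTerm_le a b (k + 1) x

lemma continuous_trigSeries : Continuous (trigSeries a b) :=
  continuous_const.add (continuous_tsum_trigTerm ha hb)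

lemma integral_trigSeries_mul_cos (j : ℕ) (d : ℝ) :
    ∫ t in (-π)..π, trigSeries a b t * cos (j * t + d) =
      π * (a j * cos d - if j = 0 then 0 else b j * sin d) := by
  have termwise := hasSum_integral_mul (summable_abs_add_abs ha hb 1)
    (fun k => continuous_trigTerm a b (k + 1)) (fun k t => abs_trigTerm_le a b (k + 1) t)
    ((by fun_prop : Continuous fun t : ℝ => cos (j * t + d)).intervalIntegrable (-π) π)
  have constant_term := integral_cos_int_mul_add j d
  simp_rw [integral_trigTerm_mul_cos a b (Nat.le_add_left 1 _)] at termwise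
  rw [Int.cast_natCast] at constant_term
  have hcont := continuous_tsum_trigTerm ha hb
  simp only [trigSeries, add_mul]
  rw [intervalIntegral.integral_add ((by fun_prop : Continuous _).intervalIntegrable _ _)
    ((by fun_prop : Continuous _).intervalIntegrable _ _), ← termwise.tsum_eq,
    intervalIntegral.integral_const_mul, constant_term]
  rcases j with _ | i
  · simp
    ring
  · rw [tsum_eq_single i fun k hk => if_neg (by omega), if_neg (by omega)]
    simp

lemma cosCoeff_trigSeries (j : ℕ) : cosCoeff (trigSeries a b) j = a j := by
  have := integral_trigSeries_mul_cos ha hb j 0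
  simp only [add_zero, cos_zero, sin_zero, mul_zero, mul_one, ite_self, sub_zero] at this
  rw [cosCoeff, this, one_div, inv_mul_cancel_left₀ pi_ne_zero]

lemma sinCoeff_trigSeries {j : ℕ} (hj : j ≠ 0) : sinCoeff (trigSeries a b) j = b j := by
  have := integral_trigSeries_mul_cos ha hb j (-(π / 2))
  simp only [← sub_eq_add_neg, cos_sub_pi_div_two] at this
  rw [sinCoeff, this, if_neg hj]
  simp

lemma fourierSum_trigSeries (m : ℕ) : fourierSum m (trigSeries a b) = trigPoly m a b := by
  funext x
  refine congrArg₂ _ (by rw [cosCoeff_trigSeries ha hb]) (Finset.sum_congr rfl fun k hk => ?_)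
  have hk1 := (Finset.mem_Icc.1 hk).1
  rw [cosCoeff_trigSeries ha hb, sinCoeff_trigSeries ha hb (by omega)]

lemma abs_trigSeries_sub_fourierSum_le (m : ℕ) (x : ℝ) :
    |trigSeries a b x - fourierSum m (trigSeries a b) x| ≤
      ∑' k, (|a (k + (m + 1))| + |b (k + (m + 1))|) := by
  rw [fourierSum_trigSeries ha hb, trigPoly_eq_sum_range, trigSeries, add_sub_add_left_eq_sub,
    ← (summable_trigTerm ha hb x).sum_add_tsum_nat_add m, add_sub_cancel_left]
  exact tsum_of_norm_bounded (f := fun k => trigTerm a b (k + (m + 1)) x)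
    (summable_abs_add_abs ha hb (m + 1)).hasSum fun k => abs_trigTerm_le a b (k + (m + 1)) x

lemma convolution_trigSeries {φ : ℝ → ℝ} (hφ : IntervalIntegrable φ volume (-π) π) (x : ℝ) :
    (1 / π) * ∫ t in (-π)..π, trigSeries a b (x - t) * φ t =
      trigSeries (fun k => a k * cosCoeff φ k - b k * sinCoeff φ k)
        (fun k => a k * sinCoeff φ k + b k * cosCoeff φ k) x := by
  have termwise := hasSum_integral_mul (summable_abs_add_abs ha hb 1)
    (u := fun k t => trigTerm a b (k + 1) (x - t)) (fun k => by fun_prop)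
    (fun k t => abs_trigTerm_le a b (k + 1) (x - t)) hφ
  have hcont : Continuous fun t => ∑' k, trigTerm a b (k + 1) (x - t) :=
    (continuous_tsum_trigTerm ha hb).comp (by fun_prop)
  simp only [trigSeries, add_mul]
  rw [intervalIntegral.integral_add (hφ.const_mul _) (hφ.continuousOn_mul hcont.continuousOn),
    mul_add, ← termwise.tsum_eq, ← tsum_mul_left, intervalIntegral.integral_const_mul,
    mul_left_comm, ← cosCoeff_zero_eq, sinCoeff_zero]
  simp_rw [convolution_trigTerm hφ]
  ring

end TrigSeries

lemma enorm_integral_mul_le {g : ℝ → ℝ} (hg : AEStronglyMeasurable g periodMeasure)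
    (h : ℝ → ℝ) :
    ‖∫ t in (-π)..π, h t * g t‖ₑ ≤ normC h * eLpNorm g 1 periodMeasure := by
  rw [intervalIntegral.integral_of_le (by linarith [pi_pos] : -π ≤ π),
    eLpNorm_one_eq_lintegral_enorm, ← lintegral_const_mul'' _ hg.enorm]
  refine (enorm_integral_le_lintegral_enorm _).trans (lintegral_mono fun t => ?_)
  rw [enorm_mul]
  gcongr
  exact le_iSup (fun t => ‖h t‖ₑ) t

lemma abs_cosCoeff_mul_cos_sub_le {φ : ℝ → ℝ} (hφ : MemLp φ 1 periodMeasure)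
    (hφ1 : eLpNorm φ 1 periodMeasure ≤ 1) (k : ℕ) (d : ℝ) :
    |cosCoeff φ k * cos d - sinCoeff φ k * sin d| ≤ 1 / π := by
  have hφi := intervalIntegrable_iff_integrable_periodMeasure.2 (memLp_one_iff_integrable.1 hφ)
  have normC_cos_le : normC (fun t => cos (k * t + d)) ≤ 1 := iSup_le fun t => by
    rw [← ofReal_norm]
    exact ENNReal.ofReal_le_one.2 (abs_cos_le_one _)
  have hint : |∫ t in (-π)..π, cos (k * t + d) * φ t| ≤ 1 := by
    rw [← norm_eq_abs, ← ENNReal.ofReal_le_one, ofReal_norm]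
    exact (enorm_integral_mul_le hφ.1 _).trans (mul_le_one' normC_cos_le hφ1)
  simp_rw [mul_comm (cos _), integral_mul_cos_add hφi] at hint
  rwa [abs_mul, abs_of_pos pi_pos, ← le_div_iff₀' pi_pos] at hint

lemma integral_comp_sub_mul_comm {F G : ℝ → ℝ} (hF : Function.Periodic F (2 * π))
    (hG : Function.Periodic G (2 * π)) (x : ℝ) :
    ∫ t in (-π)..π, F (x - t) * G t = ∫ s in (-π)..π, F s * G (x - s) := by
  have hper : Function.Periodic (fun s => F s * G (x - s)) (2 * π) := fun s => by
    simp only [hF s, sub_add_eq_sub_sub, hG.sub_eq]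
  have shift := hper.intervalIntegral_add_eq (x - π) (-π)
  rw [show x - π + 2 * π = x - -π by ring, show -π + 2 * π = π by ring] at shift
  rw [← shift, ← intervalIntegral.integral_comp_sub_left fun s => F s * G (x - s)]
  simp only [sub_sub_cancel]

/-- The cosine coefficients of `Ψ_β`. -/
noncomputable def kernelCos (ψ : ℝ → ℝ) (β : ℝ) (k : ℕ) : ℝ :=
  if k = 0 then 0 else ψ k * cos (β * π / 2)

/-- The sine coefficients of `Ψ_β`; the one of order `0` is irrelevant. -/
noncomputable def kernelSin (ψ : ℝ → ℝ) (β : ℝ) (k : ℕ) : ℝ :=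
  ψ k * sin (β * π / 2)

/-- The continuous representative of `Ψ_β`, given by its Fourier series when `∑ |ψ(k)| < ∞`. -/
noncomputable def kernel (ψ : ℝ → ℝ) (β : ℝ) : ℝ → ℝ :=
  trigSeries (kernelCos ψ β) (kernelSin ψ β)

section Kernel

variable {ψ : ℝ → ℝ} (hs : Summable fun k : ℕ => ψ k) (β : ℝ)
include hs

lemma summable_kernelCos : Summable (kernelCos ψ β) := by
  refine hs.abs.of_norm_bounded fun k => ?_
  rw [kernelCos]
  split_ifs
  · simp
  · rw [norm_mul]
    exact mul_le_of_le_one_right (abs_nonneg _) (abs_cos_le_one _)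

lemma summable_kernelSin : Summable (kernelSin ψ β) :=
  hs.mul_right _

lemma continuous_kernel : Continuous (kernel ψ β) :=
  continuous_trigSeries (summable_kernelCos hs β) (summable_kernelSin hs β)

lemma memLp_kernel (p : ℝ≥0∞) : MemLp (kernel ψ β) p periodMeasure :=
  memLp_periodMeasure (continuous_kernel hs β) p

lemma isKernel_kernel : IsKernel ψ β (kernel ψ β) where
  periodic := periodic_trigSeries _ _
  integrable := memLp_one_iff_integrable.1 (memLp_kernel hs β 1)
  cosCoeff_zero := by
    rw [kernel, cosCoeff_trigSeries (summable_kernelCos hs β) (summable_kernelSin hs β),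
      kernelCos, if_pos rfl]
  cosCoeff_eq k hk := by
    rw [kernel, cosCoeff_trigSeries (summable_kernelCos hs β) (summable_kernelSin hs β),
      kernelCos, if_neg (by omega)]
  sinCoeff_eq k hk := by
    rw [kernel, sinCoeff_trigSeries (summable_kernelCos hs β) (summable_kernelSin hs β) (by omega),
      kernelSin]

end Kernel

lemma IsKernel.ae_eq {ψ : ℝ → ℝ} {β : ℝ} {Ψ Φ : ℝ → ℝ} (hΨ : IsKernel ψ β Ψ)
    (hΦ : IsKernel ψ β Φ) (hΨ2 : MemLp Ψ 2 periodMeasure) (hΦ2 : MemLp Φ 2 periodMeasure) :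
    Ψ =ᵐ[periodMeasure] Φ := by
  refine ae_eq_of_coeff_eq hΨ2 hΦ2 (fun k => ?_) fun k => ?_ <;>
    rcases Nat.eq_zero_or_pos k with rfl | hk
  · rw [hΨ.cosCoeff_zero, hΦ.cosCoeff_zero]
  · rw [hΨ.cosCoeff_eq k hk, hΦ.cosCoeff_eq k hk]
  · rw [sinCoeff_zero, sinCoeff_zero]
  · rw [hΨ.sinCoeff_eq k hk, hΦ.sinCoeff_eq k hk]

lemma IsKernel.integral_comp_sub_mul_congr {ψ : ℝ → ℝ} {β : ℝ} {Ψ Φ : ℝ → ℝ} (hΨ : IsKernel ψ β Ψ)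
    (hΦ : IsKernel ψ β Φ) (hΨ2 : MemLp Ψ 2 periodMeasure) (hΦ2 : MemLp Φ 2 periodMeasure)
    {φ : ℝ → ℝ} (hφ : Function.Periodic φ (2 * π)) (x : ℝ) :
    ∫ t in (-π)..π, Ψ (x - t) * φ t = ∫ t in (-π)..π, Φ (x - t) * φ t := by
  rw [integral_comp_sub_mul_comm hΨ.periodic hφ, integral_comp_sub_mul_comm hΦ.periodic hφ,
    intervalIntegral.integral_of_le (by linarith [pi_pos]),
    intervalIntegral.integral_of_le (by linarith [pi_pos])]
  refine integral_congr_ae ?_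
  filter_upwards [hΨ.ae_eq hΦ hΨ2 hΦ2] with s hs
  rw [hs]

lemma IsKernel.integral_comp_sub_mul_cos {ψ : ℝ → ℝ} {β : ℝ} {Ψ : ℝ → ℝ}
    (hΨ : IsKernel ψ β Ψ) {k : ℕ} (hk : 1 ≤ k) (x : ℝ) :
    ∫ t in (-π)..π, Ψ (x - t) * cos (k * t) = π * (ψ k * cos (k * x + -(β * π / 2))) := by
  have hcos : Function.Periodic (fun t : ℝ => cos (k * t)) (2 * π) := fun t => by
    simp only [mul_add, cos_add_nat_mul_two_pi]
  have reflect : ∀ s, Ψ s * cos (k * (x - s)) = Ψ s * cos (k * s + -(k * x)) := fun s => by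
    rw [← cos_neg, show -(k * (x - s)) = k * s + -(k * x) by ring]
  rw [integral_comp_sub_mul_comm hΨ.periodic hcos]
  simp_rw [reflect]
  rw [integral_mul_cos_add (intervalIntegrable_iff_integrable_periodMeasure.2 hΨ.integrable),
    hΨ.cosCoeff_eq k hk, hΨ.sinCoeff_eq k hk, cos_add, cos_neg, sin_neg, cos_neg, sin_neg]
  ring

lemma abs_kernel_mul_coeff_le (ψ : ℝ → ℝ) (β : ℝ) {φ : ℝ → ℝ} (hφ : MemLp φ 1 periodMeasure)
    (hφ1 : eLpNorm φ 1 periodMeasure ≤ 1) {k : ℕ} (hk : k ≠ 0) :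
    |kernelCos ψ β k * cosCoeff φ k - kernelSin ψ β k * sinCoeff φ k| ≤ |ψ k| * (1 / π) ∧
      |kernelCos ψ β k * sinCoeff φ k + kernelSin ψ β k * cosCoeff φ k| ≤ |ψ k| * (1 / π) := by
  have hcos : kernelCos ψ β k * cosCoeff φ k - kernelSin ψ β k * sinCoeff φ k =
      ψ k * (cosCoeff φ k * cos (β * π / 2) - sinCoeff φ k * sin (β * π / 2)) := by
    rw [kernelCos, kernelSin, if_neg hk]
    ring
  have hsin : kernelCos ψ β k * sinCoeff φ k + kernelSin ψ β k * cosCoeff φ k =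
      -(ψ k * (cosCoeff φ k * cos (β * π / 2 + π / 2) -
        sinCoeff φ k * sin (β * π / 2 + π / 2))) := by
    rw [kernelCos, kernelSin, if_neg hk, cos_add_pi_div_two, sin_add_pi_div_two]
    ring
  rw [hcos, hsin, abs_neg, abs_mul, abs_mul]
  exact ⟨mul_le_mul_of_nonneg_left (abs_cosCoeff_mul_cos_sub_le hφ hφ1 k _) (abs_nonneg _),
    mul_le_mul_of_nonneg_left (abs_cosCoeff_mul_cos_sub_le hφ hφ1 k _) (abs_nonneg _)⟩

lemma exists_trigSeries_of_mem_classC {ψ : ℝ → ℝ} (hs : Summable fun k : ℕ => ψ k) {β : ℝ}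
    {f : ℝ → ℝ} (hf : f ∈ classC ψ β 1) :
    ∃ a b : ℕ → ℝ, Summable a ∧ Summable b ∧ f = trigSeries a b ∧
      ∀ k ≠ 0, |a k| ≤ |ψ k| * (1 / π) ∧ |b k| ≤ |ψ k| * (1 / π) := by
  obtain ⟨-, Ψ, φ, a₀, hΨ, hΨL, hφper, hφ, hφ1, -, hfx⟩ := hf
  have hφi := intervalIntegrable_iff_integrable_periodMeasure.2 (memLp_one_iff_integrable.1 hφ)
  have hΨ2 : MemLp Ψ 2 periodMeasure :=
    hΨL.mono_exponent (by simp [ENNReal.conjExponent] : (2 : ℝ≥0∞) ≤ ENNReal.conjExponent 1)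
  let a : ℕ → ℝ := Function.update
    (fun k => kernelCos ψ β k * cosCoeff φ k - kernelSin ψ β k * sinCoeff φ k) 0 a₀
  let b : ℕ → ℝ := fun k => kernelCos ψ β k * sinCoeff φ k + kernelSin ψ β k * cosCoeff φ k
  have bound : ∀ k ≠ 0, |a k| ≤ |ψ k| * (1 / π) ∧ |b k| ≤ |ψ k| * (1 / π) := fun k hk => by
    simpa only [a, b, Function.update_of_ne hk] using abs_kernel_mul_coeff_le ψ β hφ hφ1 hk
  have summable_of_bound : ∀ c : ℕ → ℝ, (∀ k ≠ 0, |c k| ≤ |ψ k| * (1 / π)) → Summable c :=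
    fun c hc => (hs.abs.mul_right (1 / π)).of_norm_bounded_eventually_nat <| by
      filter_upwards [Filter.eventually_ne_atTop 0] with k hk using hc k hk
  refine ⟨a, b, summable_of_bound a fun k hk => (bound k hk).1,
    summable_of_bound b fun k hk => (bound k hk).2, funext fun x => ?_, bound⟩
  rw [hfx, hΨ.integral_comp_sub_mul_congr (isKernel_kernel hs β) hΨ2 (memLp_kernel hs β 2) hφper,
    kernel, convolution_trigSeries (summable_kernelCos hs β) (summable_kernelSin hs β) hφi,
    trigSeries_update_zero, kernelCos, if_pos rfl, sinCoeff_zero]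
  ring

lemma fourierApprox_le {ψ : ℝ → ℝ} (hs : Summable fun k : ℕ => ψ k) (β : ℝ) {n : ℕ}
    (hn : 1 ≤ n) :
    fourierApprox n (classC ψ β 1) ≤ ENNReal.ofReal (2 / π * ∑' k : ℕ, |ψ (k + n : ℕ)|) := by
  refine iSup₂_le fun f hf => iSup_le fun x => ?_
  obtain ⟨a, b, ha, hb, rfl, hab⟩ := exists_trigSeries_of_mem_classC hs hf
  obtain ⟨m, rfl⟩ := Nat.exists_eq_add_of_le' hn
  rw [← ofReal_norm, ← tsum_mul_left]
  refine ENNReal.ofReal_le_ofReal ((abs_trigSeries_sub_fourierSum_le ha hb m x).trans ?_)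
  refine Summable.tsum_le_tsum (fun k => ?_) (summable_abs_add_abs ha hb (m + 1))
    (((summable_nat_add_iff (m + 1)).2 hs.abs).mul_left _)
  obtain ⟨hak, hbk⟩ := hab (k + (m + 1)) (by omega)
  exact (add_le_add hak hbk).trans_eq (by ring)

lemma bestApprox_le_fourierApprox (n : ℕ) (N : Set (ℝ → ℝ)) :
    bestApprox n N ≤ fourierApprox n N :=
  iSup₂_mono fun f _ => iInf₂_le (fourierSum (n - 1) f) ⟨_, _, rfl⟩

/-- The polynomial `∑_{k ∈ S} w_k cos(kx + d)` with frequencies in `S` and common phase `d`. -/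
noncomputable def cosPoly (S : Finset ℕ) (w : ℕ → ℝ) (d x : ℝ) : ℝ :=
  ∑ k ∈ S, w k * cos (k * x + d)

@[fun_prop]
lemma continuous_cosPoly (S : Finset ℕ) (w : ℕ → ℝ) (d : ℝ) : Continuous (cosPoly S w d) := by
  unfold cosPoly
  fun_prop

lemma periodic_cosPoly (S : Finset ℕ) (w : ℕ → ℝ) (d : ℝ) :
    Function.Periodic (cosPoly S w d) (2 * π) := fun x => by
  refine Finset.sum_congr rfl fun k _ => ?_
  rw [mul_add, add_right_comm, cos_add_nat_mul_two_pi]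

lemma cosPoly_const_mul (S : Finset ℕ) (c : ℝ) (w : ℕ → ℝ) (d x : ℝ) :
    cosPoly S (fun k => c * w k) d x = c * cosPoly S w d x := by
  simp only [cosPoly, Finset.mul_sum, mul_assoc]

lemma integral_mul_cosPoly {F : ℝ → ℝ} {p q : ℝ} (hF : IntervalIntegrable F volume p q)
    (S : Finset ℕ) (w : ℕ → ℝ) (d : ℝ) :
    ∫ x in p..q, F x * cosPoly S w d x = ∑ k ∈ S, w k * ∫ x in p..q, F x * cos (k * x + d) := by
  have expand : ∀ x, F x * cosPoly S w d x = ∑ k ∈ S, w k * (F x * cos (k * x + d)) := fun x => by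
    rw [cosPoly, Finset.mul_sum]
    exact Finset.sum_congr rfl fun k _ => by ring
  simp_rw [expand]
  rw [intervalIntegral.integral_finsetSum fun k _ =>
    (hF.mul_continuousOn (by fun_prop)).const_mul _]
  simp_rw [intervalIntegral.integral_const_mul]

lemma integral_cosPoly_mul_cosPoly {S : Finset ℕ} (hS : ∀ k ∈ S, 1 ≤ k) (v w : ℕ → ℝ) (d : ℝ) :
    ∫ x in (-π)..π, cosPoly S v d x * cosPoly S w d x = π * ∑ k ∈ S, v k * w k := by
  rw [integral_mul_cosPoly ((continuous_cosPoly S v d).intervalIntegrable _ _), Finset.mul_sum]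
  refine Finset.sum_congr rfl fun k hk => ?_
  simp_rw [mul_comm (cosPoly S v d _)]
  rw [integral_mul_cosPoly ((by fun_prop : Continuous _).intervalIntegrable _ _),
    Finset.sum_congr rfl fun l _ => by rw [integral_cos_mul_cos (hS k hk)]]
  simp only [sub_self, cos_zero, mul_one, mul_ite, mul_zero, Finset.sum_ite_eq, if_pos hk]
  ring

lemma integral_trigPoly_mul_cosPoly {m : ℕ} (a b : ℕ → ℝ) {S : Finset ℕ} (hS : ∀ k ∈ S, m < k)
    (w : ℕ → ℝ) (d : ℝ) : ∫ x in (-π)..π, trigPoly m a b x * cosPoly S w d x = 0 := by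
  rw [integral_mul_cosPoly ((continuous_trigPoly m a b).intervalIntegrable _ _)]
  refine Finset.sum_eq_zero fun k hk => ?_
  rw [integral_trigPoly_mul_cos a b (hS k hk), mul_zero]

lemma enorm_integral_mul_cosPoly_le_iInf {f : ℝ → ℝ} (hf : Continuous f) {m : ℕ} {S : Finset ℕ}
    (hS : ∀ k ∈ S, m < k) {w : ℕ → ℝ} {d : ℝ} (hw : eLpNorm (cosPoly S w d) 1 periodMeasure ≤ 1) :
    ‖∫ x in (-π)..π, f x * cosPoly S w d x‖ₑ ≤
      ⨅ T ∈ trigPolys m, normC (fun x => f x - T x) := by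
  refine le_iInf₂ fun T ⟨a, b, hT⟩ => ?_
  have orthogonal : ∫ x in (-π)..π, (f x - T x) * cosPoly S w d x =
      ∫ x in (-π)..π, f x * cosPoly S w d x := by
    simp_rw [hT, sub_mul]
    rw [intervalIntegral.integral_sub ((by fun_prop : Continuous _).intervalIntegrable _ _)
      ((by fun_prop : Continuous _).intervalIntegrable _ _),
      integral_trigPoly_mul_cosPoly a b hS, sub_zero]
  rw [← orthogonal]
  exact (enorm_integral_mul_le (continuous_cosPoly S w d).aestronglyMeasurable _).trans
    (mul_le_of_le_one_right' hw)

lemma cosPoly_mem_classC {ψ : ℝ → ℝ} (hs : Summable fun k : ℕ => ψ k) (β : ℝ) {S : Finset ℕ}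
    (hS : ∀ k ∈ S, 1 ≤ k) {w : ℕ → ℝ} (hw : eLpNorm (cosPoly S w 0) 1 periodMeasure ≤ 1) :
    cosPoly S (fun k => ψ k * w k) (-(β * π / 2)) ∈ classC ψ β 1 := by
  refine ⟨continuous_cosPoly _ _ _, kernel ψ β, cosPoly S w 0, 0, isKernel_kernel hs β,
    memLp_kernel hs β _, periodic_cosPoly S w 0, memLp_periodMeasure (by fun_prop) 1, hw, ?_,
    fun x => ?_⟩
  · have orthogonal := integral_trigPoly_mul_cosPoly (m := 0) (fun _ => 2) 0 hS w 0
    simpa [trigPoly] using orthogonal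
  · have hcont : Continuous fun t => kernel ψ β (x - t) :=
      (continuous_kernel hs β).comp (by fun_prop)
    rw [integral_mul_cosPoly (hcont.intervalIntegrable _ _), zero_div, zero_add, Finset.mul_sum,
      cosPoly]
    refine Finset.sum_congr rfl fun k hk => ?_
    simp_rw [add_zero]
    rw [(isKernel_kernel hs β).integral_comp_sub_mul_cos (hS k hk)]
    field_simp

lemma ofReal_sum_mul_sq_le_bestApprox {ψ : ℝ → ℝ} (hs : Summable fun k : ℕ => ψ k) (β : ℝ)
    {n : ℕ} (hn : 1 ≤ n) {S : Finset ℕ} (hS : ∀ k ∈ S, n ≤ k) {w : ℕ → ℝ}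
    (hw : ∀ d, eLpNorm (cosPoly S w d) 1 periodMeasure ≤ 1) :
    ENNReal.ofReal (π * ∑ k ∈ S, ψ k * w k ^ 2) ≤ bestApprox n (classC ψ β 1) := by
  have hmem := cosPoly_mem_classC hs β (fun k hk => hn.trans (hS k hk)) (hw 0)
  refine le_iSup₂_of_le _ hmem (le_trans ?_ (enorm_integral_mul_cosPoly_le_iInf
    (continuous_cosPoly _ _ _) (fun k hk => by have := hS k hk; omega) (hw (-(β * π / 2)))))
  rw [integral_cosPoly_mul_cosPoly fun k hk => hn.trans (hS k hk), ← ofReal_norm]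
  simp_rw [mul_assoc, ← sq]
  exact ENNReal.ofReal_le_ofReal (le_norm_self _)

/-- The number of representations of `k` as an ordered sum of two elements of `A`. -/
def repCount (A : Finset ℕ) (k : ℕ) : ℕ :=
  #{p ∈ A ×ˢ A | p.1 + p.2 = k}

lemma cosPoly_repCount (A : Finset ℕ) (d x : ℝ) :
    cosPoly (A + A) (fun k => repCount A k) d x =
      ∑ p ∈ A ×ˢ A, cos ((p.1 + p.2 : ℕ) * x + d) := by
  rw [Finset.sum_comp (fun k : ℕ => cos (k * x + d)) (fun p : ℕ × ℕ => p.1 + p.2)]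
  simp only [cosPoly, repCount, nsmul_eq_mul, Finset.image_add_product]

lemma cosPoly_repCount_eq_sq_sub_sq (A : Finset ℕ) (d x : ℝ) :
    cosPoly (A + A) (fun k => repCount A k) d x =
      cosPoly A 1 (d / 2) x ^ 2 - cosPoly A 1 (d / 2 - π / 2) x ^ 2 := by
  rw [cosPoly_repCount]
  simp only [cosPoly, Pi.one_apply, one_mul, ← add_sub_assoc, cos_sub_pi_div_two, sq,
    Finset.sum_mul_sum, ← Finset.sum_product', ← Finset.sum_sub_distrib]
  refine Finset.sum_congr rfl fun p _ => ?_
  rw [← cos_add]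
  push_cast
  ring_nf

lemma integral_abs_cosPoly_repCount_le {A : Finset ℕ} (hA : ∀ k ∈ A, 1 ≤ k) (d : ℝ) :
    ∫ x in (-π)..π, |cosPoly (A + A) (fun k => repCount A k) d x| ≤ 2 * π * #A := by
  have norm_sq : ∀ e, ∫ x in (-π)..π, cosPoly A 1 e x ^ 2 = π * #A := fun e => by
    simp_rw [sq, integral_cosPoly_mul_cosPoly hA]
    simp
  calc ∫ x in (-π)..π, |cosPoly (A + A) (fun k => repCount A k) d x|
      ≤ ∫ x in (-π)..π, (cosPoly A 1 (d / 2) x ^ 2 + cosPoly A 1 (d / 2 - π / 2) x ^ 2) := by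
        refine intervalIntegral.integral_mono (by linarith [pi_pos])
          ((by fun_prop : Continuous _).intervalIntegrable _ _)
          ((by fun_prop : Continuous _).intervalIntegrable _ _) fun x => ?_
        rw [cosPoly_repCount_eq_sq_sub_sq]
        exact (abs_sub _ _).trans_eq (by simp only [abs_sq])
    _ = 2 * π * #A := by
        rw [intervalIntegral.integral_add ((by fun_prop : Continuous _).intervalIntegrable _ _)
          ((by fun_prop : Continuous _).intervalIntegrable _ _), norm_sq, norm_sq]
        ring

lemma eLpNorm_one_periodMeasure {F : ℝ → ℝ} (hF : Continuous F) :
    eLpNorm F 1 periodMeasure = ENNReal.ofReal (∫ x in (-π)..π, |F x|) := by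
  rw [eLpNorm_one_eq_lintegral_enorm, intervalIntegral.integral_of_le (by linarith [pi_pos])]
  exact (ofReal_integral_norm_eq_lintegral_enorm
    (memLp_one_iff_integrable.1 (memLp_periodMeasure hF 1))).symm

lemma eLpNorm_cosPoly_normalized_repCount_le {A : Finset ℕ} (hA : ∀ k ∈ A, 1 ≤ k) (d : ℝ) :
    eLpNorm (cosPoly (A + A) (fun k => (2 * π * #A)⁻¹ * repCount A k) d) 1 periodMeasure ≤ 1 := by
  rw [eLpNorm_one_periodMeasure (continuous_cosPoly _ _ _), ENNReal.ofReal_le_one]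
  have hnonneg : (0 : ℝ) ≤ (2 * π * #A)⁻¹ := by positivity
  simp_rw [cosPoly_const_mul, abs_mul, abs_of_nonneg hnonneg, intervalIntegral.integral_const_mul]
  exact (mul_le_mul_of_nonneg_left (integral_abs_cosPoly_repCount_le hA d) hnonneg).trans
    inv_mul_le_one

lemma ofReal_mul_addEnergy_le_bestApprox {ψ : ℝ → ℝ} (hs : Summable fun k : ℕ => ψ k) (β : ℝ)
    {n : ℕ} (hn : 1 ≤ n) {A : Finset ℕ} (hA : ∀ k ∈ A, 1 ≤ k) (hAn : ∀ k ∈ A + A, n ≤ k)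
    {c : ℝ} (hc : ∀ k ∈ A + A, c ≤ ψ k) :
    ENNReal.ofReal (c * A.addEnergy A / (4 * π * #A ^ 2)) ≤ bestApprox n (classC ψ β 1) := by
  refine le_trans (ENNReal.ofReal_le_ofReal ?_) (ofReal_sum_mul_sq_le_bestApprox hs β hn hAn
    (eLpNorm_cosPoly_normalized_repCount_le hA))
  calc c * A.addEnergy A / (4 * π * #A ^ 2)
      = π * ∑ k ∈ A + A, c * ((2 * π * #A)⁻¹ * repCount A k) ^ 2 := by
        rw [Finset.addEnergy_eq_sum_sq', ← Finset.mul_sum]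
        simp_rw [mul_pow, ← Finset.mul_sum, repCount]
        push_cast
        field_simp
        ring
    _ ≤ π * ∑ k ∈ A + A, ψ k * ((2 * π * #A)⁻¹ * repCount A k) ^ 2 := by
        gcongr with k hk
        exact hc k hk

lemma Ico_add_Ico_subset (n : ℕ) :
    Finset.Ico n (2 * n) + Finset.Ico n (2 * n) ⊆ Finset.Ico (2 * n) (4 * n) := by
  intro k hk
  obtain ⟨i, hi, j, hj, rfl⟩ := Finset.mem_add.1 hk
  rw [Finset.mem_Ico] at *
  omega

lemma pow_three_le_two_mul_addEnergy_Ico (n : ℕ) :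
    n ^ 3 ≤ 2 * (Finset.Ico n (2 * n)).addEnergy (Finset.Ico n (2 * n)) := by
  obtain rfl | hn := n.eq_zero_or_pos
  · simp
  have cauchy := Finset.le_card_add_mul_addEnergy (Finset.Ico n (2 * n)) (Finset.Ico n (2 * n))
  have card_le := Finset.card_le_card (Ico_add_Ico_subset n)
  simp only [Nat.card_Ico, show 2 * n - n = n by omega, show 4 * n - 2 * n = 2 * n by omega]
    at cauchy card_le
  refine Nat.le_of_mul_le_mul_left ?_ hn
  calc n * n ^ 3 = n ^ 2 * n ^ 2 := by ring
    _ ≤ 2 * n * _ := cauchy.trans (Nat.mul_le_mul_right _ card_le)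
    _ = _ := by ring

lemma ofReal_mul_le_bestApprox {ψ : ℝ → ℝ} (hs : Summable fun k : ℕ => ψ k) (β : ℝ) {n : ℕ}
    (hn : 1 ≤ n) {c : ℝ} (hc₀ : 0 ≤ c) (hc : ∀ k ∈ Finset.Ico (2 * n) (4 * n), c ≤ ψ k) :
    ENNReal.ofReal (c * n / (8 * π)) ≤ bestApprox n (classC ψ β 1) := by
  set A := Finset.Ico n (2 * n) with hA
  have hcard : #A = n := by rw [hA, Nat.card_Ico]; omega
  have hmem : ∀ k ∈ A + A, k ∈ Finset.Ico (2 * n) (4 * n) := Ico_add_Ico_subset n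
  refine le_trans (ENNReal.ofReal_le_ofReal ?_) (ofReal_mul_addEnergy_le_bestApprox hs β hn (A := A)
    (fun k hk => hn.trans (Finset.mem_Ico.1 hk).1)
    (fun k hk => by have := (Finset.mem_Ico.1 (hmem k hk)).1; omega)
    fun k hk => hc k (hmem k hk))
  have energy : (n : ℝ) ^ 3 ≤ 2 * A.addEnergy A := mod_cast pow_three_le_two_mul_addEnergy_Ico n
  have hn₀ : (0 : ℝ) < n := by exact_mod_cast hn
  rw [hcard, div_le_div_iff₀ (by positivity) (mul_pos (by positivity) (pow_pos hn₀ 2))]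
  linear_combination (4 * π * c) * energy

lemma tsum_nat_add_succ_rpow_le {α : ℝ} (hα : 1 < α) {n : ℕ} (hn : 1 ≤ n) :
    ∑' k : ℕ, ((k + n + 1 : ℕ) : ℝ) ^ (-α) ≤ (n : ℝ) ^ (1 - α) / (α - 1) := by
  have hn₀ : (0 : ℝ) < n := by exact_mod_cast hn
  have anti : AntitoneOn (fun t : ℝ => t ^ (-α)) (Set.Ici n) := fun s hs t _ hst =>
    rpow_le_rpow_of_nonpos (hn₀.trans_le hs) hst (by linarith)
  refine (anti.tsum_comp_add_le_integral n (integrableOn_Ioi_rpow_of_lt (by linarith) hn₀)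
    fun t ht => rpow_nonneg (hn₀.trans ht).le _).trans_eq ?_
  rw [integral_Ioi_rpow_of_lt (by linarith) hn₀, neg_add_eq_sub, ← neg_sub α 1, neg_div_neg_eq]

/-- A sequence `v` is almost decreasing with constant `L` if `v l ≤ L * v k` whenever `1 ≤ k < l`;
the term `v 0` is disregarded because `ψ` is only given on `[1, ∞)`. -/
def AlmostDecreasing (L : ℝ) (v : ℕ → ℝ) : Prop :=
  ∀ k l : ℕ, 1 ≤ k → k < l → v l ≤ L * v k

namespace AlmostDecreasing

variable {u : ℕ → ℝ} {α L : ℝ}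

lemma const_pos {v : ℕ → ℝ} (hdec : AlmostDecreasing L v) (hpos : ∀ k, 1 ≤ k → 0 < v k) :
    0 < L :=
  pos_of_mul_pos_left ((hpos 2 one_le_two).trans_le (hdec 1 2 le_rfl one_lt_two))
    (hpos 1 le_rfl).le

variable (hdec : AlmostDecreasing L fun k => (k : ℝ) ^ α * u k)
include hdec

lemma le_mul_rpow_neg {k l : ℕ} (hk : 1 ≤ k) (hkl : k < l) :
    u l ≤ L * ((k : ℝ) ^ α * u k) * (l : ℝ) ^ (-α) := by
  have hl : (0 : ℝ) < l := by exact_mod_cast (by omega : 0 < l)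
  rw [rpow_neg hl.le, ← div_eq_mul_inv, le_div_iff₀ (by positivity), mul_comm]
  exact hdec k l hk hkl

lemma summable (hα : 1 < α) (hnonneg : ∀ k, 1 ≤ k → 0 ≤ u k) : Summable u := by
  have dominating : Summable fun k : ℕ => L * ((1 : ℕ) ^ α * u 1) * (k : ℝ) ^ (-α) :=
    (Real.summable_nat_rpow.2 (by linarith)).mul_left _
  rw [← summable_nat_add_iff 2] at dominating ⊢
  exact dominating.of_nonneg_of_le (fun k => hnonneg _ (by omega)) fun k =>
    hdec.le_mul_rpow_neg le_rfl (by omega)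

lemma tsum_nat_add_succ_le (hα : 1 < α) (hL : 0 ≤ L) (hnonneg : ∀ k, 1 ≤ k → 0 ≤ u k) {n : ℕ}
    (hn : 1 ≤ n) : ∑' k : ℕ, u (k + n + 1) ≤ L / (α - 1) * (u n * n) := by
  have hn₀ : (0 : ℝ) < n := by exact_mod_cast hn
  have hun := hnonneg n hn
  calc ∑' k : ℕ, u (k + n + 1)
      ≤ ∑' k : ℕ, L * ((n : ℝ) ^ α * u n) * ((k + n + 1 : ℕ) : ℝ) ^ (-α) :=
        ((summable_nat_add_iff (n + 1)).2 (hdec.summable hα hnonneg)).tsum_le_tsum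
          (fun k => hdec.le_mul_rpow_neg hn (by omega))
          (((summable_nat_add_iff (n + 1)).2 (Real.summable_nat_rpow.2 (by linarith))).mul_left _)
    _ ≤ L * ((n : ℝ) ^ α * u n) * ((n : ℝ) ^ (1 - α) / (α - 1)) := by
        rw [tsum_mul_left]
        gcongr
        exact tsum_nat_add_succ_rpow_le hα hn
    _ = L / (α - 1) * (u n * ((n : ℝ) ^ α * (n : ℝ) ^ (1 - α))) := by ring
    _ = L / (α - 1) * (u n * n) := by rw [← rpow_add hn₀, add_sub_cancel, rpow_one]

lemma tsum_nat_add_le (hα : 1 < α) (hL : 0 ≤ L) (hnonneg : ∀ k, 1 ≤ k → 0 ≤ u k) {n : ℕ}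
    (hn : 1 ≤ n) : ∑' k : ℕ, u (k + n) ≤ (1 + L / (α - 1)) * (u n * n) := by
  have first_le : u n ≤ u n * n := le_mul_of_one_le_right (hnonneg n hn) (by exact_mod_cast hn)
  rw [((summable_nat_add_iff n).2 (hdec.summable hα hnonneg)).tsum_eq_zero_add, zero_add]
  simp_rw [add_right_comm _ 1 n]
  linear_combination hdec.tsum_nat_add_succ_le hα hL hnonneg hn + first_le

lemma le_mul (hα : 0 ≤ α) (hL : 0 ≤ L) {k l : ℕ} (hk : 1 ≤ k) (hkl : k < l) (huk : 0 ≤ u k) :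
    u l ≤ L * u k := by
  have hl : (0 : ℝ) < l := by exact_mod_cast (by omega : 0 < l)
  refine le_of_mul_le_mul_left ?_ (rpow_pos_of_pos hl α)
  calc (l : ℝ) ^ α * u l ≤ L * ((k : ℝ) ^ α * u k) := hdec k l hk hkl
    _ ≤ L * ((l : ℝ) ^ α * u k) := by gcongr
    _ = (l : ℝ) ^ α * (L * u k) := by ring

lemma le_mul_of_doubling (hα : 0 ≤ α) (hL : 0 ≤ L) (hnonneg : ∀ k, 1 ≤ k → 0 ≤ u k) {K : ℝ}
    (hK : 0 ≤ K) (hdouble : ∀ k, 1 ≤ k → u k ≤ K * u (2 * k)) {n k : ℕ} (hk : 1 ≤ k)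
    (hn : 1 ≤ n) (hkn : k < 4 * n) : u n ≤ K ^ 2 * L * u k := calc
  u n ≤ K * (K * u (2 * (2 * n))) :=
    (hdouble n hn).trans (mul_le_mul_of_nonneg_left (hdouble _ (by omega)) hK)
  _ ≤ K * (K * (L * u k)) := by
    gcongr
    exact hdec.le_mul hα hL hk (by omega) (hnonneg k hk)
  _ = K ^ 2 * L * u k := by ring

end AlmostDecreasing

end PsiBeta

theorem mainTheorem2_general {ψ : ℝ → ℝ} (hpos : ∀ k : ℕ, 1 ≤ k → 0 < ψ k) {K : ℝ}
    (hdouble : ∀ k : ℕ, 1 ≤ k → ψ k ≤ K * ψ (2 * k : ℕ)) {α L : ℝ} (hα : 1 < α)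
    (hdec : PsiBeta.AlmostDecreasing L fun k => (k : ℝ) ^ α * ψ k) :
    ∃ K₁ K₂ : ℝ, 0 < K₁ ∧ 0 < K₂ ∧ ∀ (β : ℝ) (n : ℕ), 1 ≤ n →
      ENNReal.ofReal (K₂ * ψ n * n) ≤ PsiBeta.bestApprox n (PsiBeta.classC ψ β 1) ∧
      PsiBeta.bestApprox n (PsiBeta.classC ψ β 1) ≤
        PsiBeta.fourierApprox n (PsiBeta.classC ψ β 1) ∧
      PsiBeta.fourierApprox n (PsiBeta.classC ψ β 1) ≤ ENNReal.ofReal (K₁ * ψ n * n) := by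
  let u : ℕ → ℝ := fun k => ψ k
  replace hdec : PsiBeta.AlmostDecreasing L fun k => (k : ℝ) ^ α * u k := hdec
  have hnonneg : ∀ k, 1 ≤ k → 0 ≤ u k := fun k hk => (hpos k hk).le
  have hα₀ : 0 ≤ α := by linarith
  have hK : 0 < K :=
    pos_of_mul_pos_left ((hpos 1 le_rfl).trans_le (hdouble 1 le_rfl)) (hnonneg 2 one_le_two)
  have hL : 0 < L := hdec.const_pos fun k hk => mul_pos (by positivity) (hpos k hk)
  have hK₁ : 0 < 1 + L / (α - 1) := add_pos one_pos (div_pos hL (sub_pos.2 hα))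
  have hs := hdec.summable hα hnonneg
  refine ⟨2 / π * (1 + L / (α - 1)), 1 / (8 * π * (K ^ 2 * L)), mul_pos (by positivity) hK₁,
    by positivity, fun β n hn => ⟨?_, PsiBeta.bestApprox_le_fourierApprox n _, ?_⟩⟩
  · convert PsiBeta.ofReal_mul_le_bestApprox hs β hn (c := ψ n / (K ^ 2 * L))
      (div_nonneg (hnonneg n hn) (by positivity)) fun k hk => ?_ using 2
    · ring
    · have hk := Finset.mem_Ico.1 hk
      rw [div_le_iff₀' (by positivity)]
      exact hdec.le_mul_of_doubling hα₀ hL.le hnonneg hK.le hdouble (by omega) hn hk.2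
  · refine (PsiBeta.fourierApprox_le hs β hn).trans (ENNReal.ofReal_le_ofReal ?_)
    have tail : ∑' k : ℕ, |ψ (k + n : ℕ)| ≤ (1 + L / (α - 1)) * (ψ n * n) :=
      (tsum_congr fun k => abs_of_nonneg (hnonneg _ (hn.trans (Nat.le_add_left n k)))).trans_le
        (hdec.tsum_nat_add_le hα hL.le hnonneg hn)
    linear_combination (2 / π) * tail

theorem mainTheorem2 (ψ : ℝ → ℝ) (hψ : ψ ∈ PsiBeta.setB ∩ PsiBeta.Theta 1)
    (hΔ : (∀ k : ℕ, 1 ≤ k → 0 ≤ PsiBeta.secondDiffInv ψ k) ∨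
      (∀ k : ℕ, 1 ≤ k → PsiBeta.secondDiffInv ψ k ≤ 0)) :
    ∃ K₁ K₂ : ℝ, 0 < K₁ ∧ 0 < K₂ ∧ ∀ (β : ℝ) (n : ℕ), 1 ≤ n →
      ENNReal.ofReal (K₂ * ψ n * n) ≤ PsiBeta.bestApprox n (PsiBeta.classC ψ β 1) ∧
      PsiBeta.bestApprox n (PsiBeta.classC ψ β 1) ≤
        PsiBeta.fourierApprox n (PsiBeta.classC ψ β 1) ∧
      PsiBeta.fourierApprox n (PsiBeta.classC ψ β 1) ≤ ENNReal.ofReal (K₁ * ψ n * n) := by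
  obtain ⟨⟨hpos, -, K, -, hdouble⟩, -, -, α, hα, L, -, hdec⟩ := hψ
  refine mainTheorem2_general (fun k hk => hpos k (mod_cast hk)) (K := K) (fun k hk => ?_)
    (by simpa using hα) fun k l hk hkl => hdec l k (mod_cast hk) (mod_cast hkl)
  have hk : (1 : ℝ) ≤ k := by exact_mod_cast hk
  rw [← div_le_iff₀ (hpos _ (by push_cast; linarith))]
  exact mod_cast hdouble k hk
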